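/- Let $k$ be a field, $n\ge 0$, $R=k[x_1,\dots,x_n]$, let $<$ be a monomial order on $R$, and let $S=k[f_1,\dots,f_m]\subseteq R$ be a subalgebra generated by finitely many homogeneous polynomials (of possibly different degrees). Let $\mathrm{in}_<(S)=k[\mathrm{in}_<(g)\mid g\in S]\subseteq R$ be its initial algebra, where $\mathrm{in}_<(g)$ is the initial term of $g$ with respect to $<$; it need not be Noetherian. Grade $S$ and $\mathrm{in}_<(S)$ by total degree. For an $\mathbb N$-graded $k$-algebra $A=\bigoplus_{i\ge0}A_i$ with $A_0=k$ and all $\dim_k A_i$ finite, let $P_A(t)=\sum_{i\ge 0}(\dim_k A_i)\,t^i$. Call $A$ a Hilbert–Serre ring if $P_A$ has radius of convergence at least $1$ and, for some $e\in\mathbb N$, $(1-t)^eP_A(t)$ has a finite limit as $t\to1^-$; the least such $e$ is the Hilbert–Serre dimension $d(A)$. For a $k$-algebra $A$, let $$\mathrm{GKdim}_k(A)=\sup_V\limsup_{N\to\infty}\frac{\log\dim_k(k+V+\cdots+V^N)}{\log N},$$ where $V$ runs over the finite-dimensional $k$-subspaces of $A$. Let $\dim$ denote Krull dimension and $\mathrm{trdeg}_k$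 transcendence degree over $k$. Then $S$ and $\mathrm{in}_<(S)$ are Hilbert–Serre rings, and all their dimensions are finite and coincide: $$\dim(S)=\mathrm{trdeg}_k(S)=\mathrm{GKdim}_k(S)=d(S)=\dim(\mathrm{in}_<(S))=\mathrm{trdeg}_k(\mathrm{in}_<(S))=\mathrm{GKdim}_k(\mathrm{in}_<(S))=d(\mathrm{in}_<(S)).$$ -/

import Mathlib

open Filter Topology

noncomputable section

/-- The Gelfand-Kirillov dimension of a `k`-algebra `A`: the supremum over all finite-dimensional
subspaces `V` of `limsup log (d_V(n)) / log n`, where `d_V(n) = dim_k (k + V + ⋯ + V ^ n)`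
(in `Submodule k A`, `V ^ 0 = 1` is the image of `k`). The value is an extended real. -/
def gkDim (k A : Type*) [Field k] [CommRing A] [Algebra k A] : EReal :=
  ⨆ V : {V : Submodule k A // FiniteDimensional k V},
    limsup (fun n : ℕ =>
      ((Real.log (Module.finrank k (⨆ i ∈ Finset.range (n + 1), V.1 ^ i : Submodule k A))
        / Real.log n : ℝ) : EReal)) atTop

section Graded

variable {k A : Type*} [Field k] [CommRing A] [Algebra k A] (𝒜 : ℕ → Submodule k A)

/-- The value at the real number `t` of the Poincaré series `∑ (dim_k A_n) t ^ n`. -/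
def poincareSeries (t : ℝ) : ℝ := ∑' n : ℕ, (Module.finrank k (𝒜 n) : ℝ) * t ^ n

/-- The radius of convergence of the Poincaré series `∑ (dim_k A_n) t ^ n`. -/
def poincareRadius : ENNReal :=
  (FormalMultilinearSeries.ofScalars ℝ (fun n : ℕ => (Module.finrank k (𝒜 n) : ℝ))).radius

/-- The exponents `d` for which `(1 - t) ^ d * P(t)` has a finite limit as `t` tends to `1` from
the left. -/
def poleExponents : Set ℕ :=
  {d : ℕ | ∃ L : ℝ, Tendsto (fun t : ℝ => (1 - t) ^ d * poincareSeries 𝒜 t) (𝓝[<] 1) (𝓝 L)}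

/-- `A = ⨁ 𝒜 n` is an `ℕ`-graded ring with `A_0 = k` which is a Hilbert-Serre ring.

The radius of convergence is required to be at least `1`. As the coefficients are natural numbers,
it is then exactly `1` unless `A` is finite-dimensional over `k` (for instance `A = k`), in which
case the Poincaré series is a polynomial. -/
structure IsHilbertSerre : Prop where
  gradedMonoid : SetLike.GradedMonoid 𝒜
  isInternal : DirectSum.IsInternal 𝒜
  injective_algebraMap : Function.Injective (algebraMap k A)
  zero_eq : 𝒜 0 = 1
  finiteDimensional : ∀ n, FiniteDimensional k (𝒜 n)
  one_le_radius : 1 ≤ poincareRadius 𝒜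
  nonempty_poleExponents : (poleExponents 𝒜).Nonempty

/-- The Hilbert-Serre dimension: the least `d` for which `(1 - t) ^ d * P(t)` has a finite limit
as `t` tends to `1` from the left. -/
def hilbertSerreDim : ℕ := sInf (poleExponents 𝒜)

end Graded

section Initial

variable {k : Type*} [Field k] {n : ℕ}

/-- The grading of a subalgebra `B` of `k[x_1, …, x_n]` by total degree: the degree `i` piece
consists of the elements of `B` that are homogeneous polynomials of degree `i`. -/
def degreePiece (B : Subalgebra k (MvPolynomial (Fin n) k)) (i : ℕ) : Submodule k B :=
  (MvPolynomial.homogeneousSubmodule (Fin n) k i).comap B.val.toLinearMap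

/-- The initial algebra of `B`: the subalgebra generated by the initial terms of all elements of
`B` (the initial term of `0` being `0`). -/
def initialAlgebra (m : MonomialOrder (Fin n)) (B : Subalgebra k (MvPolynomial (Fin n) k)) :
    Subalgebra k (MvPolynomial (Fin n) k) :=
  Algebra.adjoin k (m.leadingTerm '' (B : Set (MvPolynomial (Fin n) k)))

/-- `B` is generated, as a `k`-algebra, by finitely many homogeneous polynomials (of possibly
different degrees). -/
def IsFGHomogeneous (B : Subalgebra k (MvPolynomial (Fin n) k)) : Prop :=
  ∃ F : Finset (MvPolynomial (Fin n) k),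
    (∀ f ∈ F, ∃ e : ℕ, f.IsHomogeneous e) ∧ B = Algebra.adjoin k (F : Set (MvPolynomial (Fin n) k))

end Initial

end

/-!
Let `A` be a subalgebra of `k[x_1, …, x_n]` of transcendence degree `s`. Some `n - s` of the
variables are algebraically independent over `A`; multiplying `A_{≤ N}` by their monomials of
exponents at most `N` stays in degree `O(N)`, so `dim A_{≤ N} = O(N ^ s)`. Conversely, the monomials
in `s` algebraically independent elements of `A` show that `dim A_{≤ N}` is at least of order
`N ^ s`. This gives `GKdim A = s`, and for graded `A` it shows that a pole of the Poincaré series at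
`1` has order exactly `s`.

The Poincaré series of `k[f_1, …, f_r]` is rational because, by Macaulay's theorem, it counts the
monomials outside an initial ideal. By Macaulay's theorem again, a graded subspace of
`k[x_1, …, x_n]` and the span of its initial terms have the same Poincaré series, so `S` and
`in(S)` have the same Hilbert-Serre dimension, and hence the same transcendence degree.

The Krull dimension of a domain over `k` is at most its transcendence degree. For the possibly
non-Noetherian algebra `in(S)` equality holds because inverting a single monomial makes it finitely
generated: finitely many exponents of `in(S)` generate the group spanned by all of them.
-/

noncomputable section

section KrullDimension

theorem ringKrullDim_eq_of_isIntegral_of_faithfulSMul {R S : Type*} [CommRing R] [CommRing S]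
    [Algebra R S] [Algebra.IsIntegral R S] [FaithfulSMul R S] :
    ringKrullDim S = ringKrullDim R := by
  apply le_antisymm
  · exact Order.krullDim_le_of_strictMono (PrimeSpectrum.comap (algebraMap R S))
      fun P Q h ↦ Ideal.IsIntegral.comap_lt_comap (R := R) (I := P.asIdeal) (J := Q.asIdeal) h
  · refine iSup_le fun l ↦ ?_
    obtain ⟨P, -, hP, hlo⟩ := Ideal.exists_ideal_over_prime_of_isIntegral l.head.asIdeal
      (⊥ : Ideal S) (by
        rw [Ideal.comap_bot_of_injective _ (FaithfulSMul.algebraMap_injective R S)]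
        exact bot_le)
    have : P.LiesOver l.head.asIdeal := ⟨hlo.symm⟩
    obtain ⟨M, hM, -, -⟩ := Ideal.exists_ltSeries_of_hasGoingUp l P
    rw [← hM]
    exact Order.LTSeries.length_le_krullDim M

theorem exists_trdeg_eq_ringKrullDim_of_finiteType (k B : Type*) [Field k] [CommRing B]
    [IsDomain B] [Algebra k B] [Algebra.FiniteType k B] :
    ∃ d : ℕ, Algebra.trdeg k B = d ∧ ringKrullDim B = d := by
  obtain ⟨s, g, hinj, hint⟩ := exists_integral_inj_algHom_of_fg k B
  algebraize [g.toRingHom]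
  have : Algebra.IsIntegral (MvPolynomial (Fin s) k) B := ⟨hint⟩
  have : FaithfulSMul (MvPolynomial (Fin s) k) B :=
    (faithfulSMul_iff_algebraMap_injective _ _).mpr hinj
  have : IsScalarTower k (MvPolynomial (Fin s) k) B :=
    IsScalarTower.of_algebraMap_eq fun x ↦ (g.commutes x).symm
  refine ⟨s, ?_, ?_⟩
  · have h := lift_trdeg_add_eq k (MvPolynomial (Fin s) k) B
    rw [MvPolynomial.trdeg_of_isDomain, trdeg_eq_zero (R := MvPolynomial (Fin s) k)] at h
    simpa using h.symm
  · rw [ringKrullDim_eq_of_isIntegral_of_faithfulSMul (R := MvPolynomial (Fin s) k),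
      MvPolynomial.ringKrullDim_of_isNoetherianRing, ringKrullDim_eq_zero_of_field, zero_add,
      Nat.card_fin]

variable {k A : Type*} [Field k] [CommRing A] [Algebra k A]

-- A chain of primes of `A` stays strict after contraction to the subalgebra generated by one
-- witness for each of its finitely many strict inclusions.
theorem ringKrullDim_le_of_trdeg_eq [IsDomain A] {d : ℕ} (hd : Algebra.trdeg k A = d) :
    ringKrullDim A ≤ d := by
  refine iSup_le fun l ↦ ?_
  have hlt (i : Fin l.length) : (l i.castSucc).asIdeal < (l i.succ).asIdeal :=
    l.strictMono i.castSucc_lt_succ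
  choose x hx using fun i ↦ (SetLike.lt_iff_le_and_exists.mp (hlt i)).2
  set B := Algebra.adjoin k (Set.range x)
  have : Algebra.FiniteType k B :=
    (Subalgebra.fg_iff_finiteType _).mp (Subalgebra.fg_def.mpr ⟨_, Set.finite_range x, rfl⟩)
  obtain ⟨e, he, hB⟩ := exists_trdeg_eq_ringKrullDim_of_finiteType k B
  have hed : e ≤ d := by
    have := trdeg_le_of_injective B.val Subtype.val_injective
    rw [he, hd] at this
    exact_mod_cast this
  let M : LTSeries (PrimeSpectrum B) :=
    { length := l.length
      toFun := fun i ↦ PrimeSpectrum.comap (algebraMap B A) (l i)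
      step := fun i ↦ SetLike.lt_iff_le_and_exists.mpr
        ⟨Ideal.comap_mono (hlt i).le, ⟨x i, Algebra.subset_adjoin ⟨i, rfl⟩⟩, hx i⟩ }
  calc (l.length : WithBot ℕ∞) ≤ ringKrullDim B := Order.LTSeries.length_le_krullDim M
    _ = e := hB
    _ ≤ d := by exact_mod_cast hed

theorem ringKrullDim_eq_of_finiteType_localizationAway [IsDomain A] {d : ℕ}
    (hd : Algebra.trdeg k A = d) {f : A} (hf : f ≠ 0)
    [Algebra.FiniteType k (Localization.Away f)] : ringKrullDim A = d := by
  apply le_antisymm (ringKrullDim_le_of_trdeg_eq hd)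
  have hle : Submonoid.powers f ≤ nonZeroDivisors A :=
    powers_le_nonZeroDivisors_of_noZeroDivisors hf
  let C := Localization.Away f
  have : IsDomain C := IsLocalization.isDomain_localization hle
  have : FaithfulSMul A C :=
    (faithfulSMul_iff_algebraMap_injective _ _).mpr (IsLocalization.injective C hle)
  have : Algebra.IsAlgebraic A C := IsLocalization.isAlgebraic C (Submonoid.powers f)
  obtain ⟨e, he, hC⟩ := exists_trdeg_eq_ringKrullDim_of_finiteType k C
  have hde : (d : Cardinal) = e := by
    rw [← hd, ← he, ← trdeg_add_eq k A (A := C), trdeg_eq_zero (R := A), add_zero]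
  rw [Nat.cast_injective hde, ← hC]
  refine Order.krullDim_le_of_strictMono (PrimeSpectrum.comap (algebraMap A C)) ?_
  exact Monotone.strictMono_of_injective (fun P Q h ↦ Ideal.comap_mono h)
    (PrimeSpectrum.localization_comap_injective C (Submonoid.powers f))

theorem finiteType_localizationAway_of_fg {R A : Type*} [CommRing R] [CommRing A] [Algebra R A]
    {B : Subalgebra R A} (hB : B.FG) {f : A} (h : ∀ a : A, ∃ M : ℕ, a * f ^ M ∈ B) :
    Algebra.FiniteType R (Localization.Away f) := by
  have : Algebra.FiniteType R B := (Subalgebra.fg_iff_finiteType B).mp hB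
  have : Algebra.FiniteType R (Polynomial B) := .trans (S := B) inferInstance inferInstance
  set u : Localization.Away f := IsLocalization.Away.invSelf f
  have hu : algebraMap A (Localization.Away f) f * u = 1 := IsLocalization.Away.mul_invSelf f
  refine .of_surjective ((Polynomial.aeval (R := B) u).restrictScalars R) fun c ↦ ?_
  obtain ⟨m, a, ha⟩ := IsLocalization.Away.surj f c
  obtain ⟨M, hM⟩ := h a
  refine ⟨Polynomial.monomial (m + M) ⟨a * f ^ M, hM⟩, ?_⟩
  calc Polynomial.aeval u (Polynomial.monomial (m + M) (⟨a * f ^ M, hM⟩ : B))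
      = algebraMap A (Localization.Away f) (a * f ^ M) * u ^ (m + M) :=
        Polynomial.aeval_monomial u
    _ = c * (algebraMap A _ f * u) ^ (m + M) := by rw [map_mul, map_pow, ← ha]; ring
    _ = c := by rw [hu, one_pow, mul_one]

end KrullDimension

section Growth

/-- The submodule `R + V + ⋯ + V ^ N` of an `R`-algebra; over a field, its dimension as a function
of `N` is the growth function of `V`. -/
def sumPowers {R A : Type*} [CommSemiring R] [Semiring A] [Algebra R A] (V : Submodule R A)
    (N : ℕ) : Submodule R A :=
  ⨆ i ∈ Finset.range (N + 1), V ^ i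

theorem sumPowers_le_iff {R A : Type*} [CommSemiring R] [Semiring A] [Algebra R A]
    {V W : Submodule R A} {N : ℕ} : sumPowers V N ≤ W ↔ ∀ i ≤ N, V ^ i ≤ W := by
  simp [sumPowers]

theorem pow_le_sumPowers {R A : Type*} [CommSemiring R] [Semiring A] [Algebra R A]
    (V : Submodule R A) {i N : ℕ} (hi : i ≤ N) : V ^ i ≤ sumPowers V N :=
  sumPowers_le_iff.mp le_rfl i hi

instance {k A : Type*} [Field k] [Ring A] [Algebra k A] (V : Submodule k A)
    [FiniteDimensional k V] (N : ℕ) : FiniteDimensional k (sumPowers V N) := by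
  have (i : ℕ) : FiniteDimensional k (V ^ i : Submodule k A) :=
    Module.Finite.iff_fg.mpr ((Module.Finite.iff_fg.mp inferInstance).pow i)
  rw [sumPowers, ← Finset.sup_eq_iSup]
  exact Submodule.finiteDimensional_finset_sup _ _

theorem linearIndependent_prod_pow {ι R A : Type*} [Fintype ι] [CommRing R] [CommRing A]
    [Algebra R A] {y : ι → A} (hy : AlgebraicIndependent R y) (M : ℕ) :
    LinearIndependent R (fun α : ι → Fin (M + 1) ↦ ∏ i, y i ^ (α i : ℕ)) := by
  let c (α : ι → Fin (M + 1)) : ι →₀ ℕ := Finsupp.equivFunOnFinite.symm fun i ↦ α i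
  have hc : Function.Injective c := fun α β h ↦
    funext fun i ↦ Fin.ext (DFunLike.congr_fun h i)
  have h := ((MvPolynomial.basisMonomials ι R).linearIndependent.map'
    (MvPolynomial.aeval y).toLinearMap (LinearMap.ker_eq_bot.mpr hy)).comp c hc
  have heq (α : ι → Fin (M + 1)) :
      MvPolynomial.aeval y (MvPolynomial.basisMonomials ι R (c α)) = ∏ i, y i ^ (α i : ℕ) := by
    simp [c, MvPolynomial.aeval_monomial, Finsupp.prod_fintype]
  simp only [← heq]
  exact h

theorem finrank_mul_card_le_finrank {k A R κ : Type*} [Field k] [CommRing A] [Algebra k A]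
    [CommRing R] [Algebra k R] [Algebra A R] [IsScalarTower k A R] [Fintype κ]
    (U : Submodule k A) {c : κ → R} (hc : LinearIndependent A c) (W : Submodule k R)
    [FiniteDimensional k U] [FiniteDimensional k W] (hUW : ∀ u ∈ U, ∀ j, u • c j ∈ W) :
    Module.finrank k U * Fintype.card κ ≤ Module.finrank k W := by
  let b := Module.finBasis k U
  have hb : LinearIndependent k fun i ↦ (b i : A) :=
    b.linearIndependent.map' U.subtype (Submodule.ker_subtype U)
  calc Module.finrank k U * Fintype.card κ
      = Module.finrank k (Submodule.span k (Set.range fun p : _ × κ ↦ (b p.1 : A) • c p.2)) := by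
        simpa using (finrank_span_eq_card (linearIndependent_smul hb hc)).symm
    _ ≤ Module.finrank k W := Submodule.finrank_mono <| Submodule.span_le.mpr <| by
        rintro - ⟨p, rfl⟩
        exact hUW _ (b p.1).2 p.2

theorem exists_algebraicIndependent_of_trdeg_eq {k A : Type*} [Field k] [CommRing A] [IsDomain A]
    [Algebra k A] {s : ℕ} (hs : Algebra.trdeg k A = s) :
    ∃ y : Fin s → A, AlgebraicIndependent k y := by
  obtain ⟨ι, x, hx⟩ := exists_isTranscendenceBasis' k A
  obtain ⟨e⟩ : Nonempty (Fin s ≃ ι) := by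
    simp [← Cardinal.lift_mk_eq', hx.cardinalMk_eq_trdeg, hs]
  exact ⟨x ∘ e, hx.1.comp e e.injective⟩

theorem succ_pow_le_mul_succ_div_pow {D : ℕ} (hD : 0 < D) (s N : ℕ) :
    (N + 1) ^ s ≤ D ^ s * (N / D + 1) ^ s := by
  rw [← mul_pow]
  exact Nat.pow_le_pow_left (Nat.lt_mul_div_succ N hD) s

theorem exists_pow_le_finrank_sumPowers {k A : Type*} [Field k] [CommRing A] [IsDomain A]
    [Algebra k A] {s : ℕ} (hs : Algebra.trdeg k A = s) :
    ∃ V : Submodule k A, FiniteDimensional k V ∧ ∃ D : ℕ, ∀ N, (N + 1) ^ s ≤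
      D * Module.finrank k (sumPowers V N) := by
  obtain ⟨y, hy⟩ := exists_algebraicIndependent_of_trdeg_eq hs
  set V := Submodule.span k (Set.range y)
  have hV : FiniteDimensional k V := FiniteDimensional.span_of_finite k (Set.finite_range y)
  refine ⟨V, hV, (s + 1) ^ s, fun N ↦
    (succ_pow_le_mul_succ_div_pow s.succ_pos s N).trans (Nat.mul_le_mul_left _ ?_)⟩
  set M := N / (s + 1)
  have hmem (α : Fin s → Fin (M + 1)) : ∏ i, y i ^ (α i : ℕ) ∈ sumPowers V N := by
    have hprod : ∏ i, y i ^ (α i : ℕ) ∈ V ^ ∑ i, (α i : ℕ) • 1 :=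
      SetLike.prod_pow_mem_graded (V ^ · : ℕ → Submodule k A) (fun _ ↦ 1) y _ fun i _ ↦ by
        simpa using Submodule.subset_span (Set.mem_range_self i)
    refine pow_le_sumPowers V ?_ hprod
    calc ∑ i, (α i : ℕ) • 1 ≤ ∑ _i : Fin s, M :=
          Finset.sum_le_sum fun i _ ↦ by simpa using Nat.lt_succ_iff.mp (α i).2
      _ = s * M := by simp
      _ ≤ (s + 1) * M := Nat.mul_le_mul_right M s.le_succ
      _ ≤ N := Nat.mul_div_le N (s + 1)
  simpa using finrank_mul_card_le_finrank (⊤ : Submodule k k) (linearIndependent_prod_pow hy M)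
    (sumPowers V N) fun u _ α ↦ Submodule.smul_mem _ u (hmem α)

theorem tendsto_add_mul_log_div_log (c s : ℝ) :
    Tendsto (fun N : ℕ ↦ (((c + s * Real.log N) / Real.log N : ℝ) : EReal)) atTop
      (𝓝 (s : EReal)) := by
  refine (continuous_coe_real_ereal.tendsto s).comp ?_
  have hlog : Tendsto (fun N : ℕ ↦ Real.log N) atTop atTop :=
    Real.tendsto_log_atTop.comp tendsto_natCast_atTop_atTop
  have h : Tendsto (fun N : ℕ ↦ c / Real.log N + s) atTop (𝓝 (0 + s)) :=
    (tendsto_const_nhds.div_atTop hlog).add tendsto_const_nhds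
  rw [zero_add] at h
  refine h.congr' ?_
  filter_upwards [hlog.eventually_gt_atTop 0] with N hN
  field_simp

theorem limsup_log_div_log_le {u : ℕ → ℕ} {C s : ℕ} (h : ∀ N, u N ≤ C * (N + 1) ^ s) :
    limsup (fun N : ℕ ↦ ((Real.log (u N) / Real.log N : ℝ) : EReal)) atTop ≤ ((s : ℝ) : EReal) := by
  rw [← (tendsto_add_mul_log_div_log (Real.log (C * 2 ^ s : ℕ)) s).limsup_eq]
  refine limsup_le_limsup ?_
  filter_upwards [eventually_ge_atTop 1] with N hN
  have hu : u N ≤ C * 2 ^ s * N ^ s := by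
    calc u N ≤ C * (N + 1) ^ s := h N
      _ ≤ C * (2 * N) ^ s := by gcongr; lia
      _ = C * 2 ^ s * N ^ s := by rw [mul_pow, mul_assoc]
  rw [EReal.coe_le_coe_iff]
  refine div_le_div_of_nonneg_right ?_ (Real.log_natCast_nonneg N)
  rcases Nat.eq_zero_or_pos (u N) with h0 | hpos
  · rw [h0, Nat.cast_zero, Real.log_zero]
    exact add_nonneg (Real.log_natCast_nonneg _)
      (mul_nonneg s.cast_nonneg (Real.log_natCast_nonneg N))
  · have hC : ((C * 2 ^ s : ℕ) : ℝ) ≠ 0 :=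
      Nat.cast_ne_zero.mpr (Nat.pos_of_mul_pos_right (hpos.trans_le hu)).ne'
    rw [← Real.log_pow, ← Real.log_mul hC (by positivity)]
    exact Real.log_le_log (by exact_mod_cast hpos) (by exact_mod_cast hu)

theorem le_limsup_log_div_log {u : ℕ → ℕ} {D s : ℕ} (h : ∀ N, (N + 1) ^ s ≤ D * u N) :
    ((s : ℝ) : EReal) ≤ limsup (fun N : ℕ ↦ ((Real.log (u N) / Real.log N : ℝ) : EReal)) atTop := by
  rw [← (tendsto_add_mul_log_div_log (-Real.log D) s).limsup_eq]
  refine limsup_le_limsup ?_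
  filter_upwards [eventually_ge_atTop 1] with N hN
  rw [EReal.coe_le_coe_iff]
  refine div_le_div_of_nonneg_right ?_ (Real.log_natCast_nonneg N)
  have hpos : 0 < D * u N := (Nat.pow_pos N.succ_pos).trans_le (h N)
  have hD : (D : ℝ) ≠ 0 := Nat.cast_ne_zero.mpr (Nat.pos_of_mul_pos_right hpos).ne'
  have hu : (u N : ℝ) ≠ 0 := Nat.cast_ne_zero.mpr (Nat.pos_of_mul_pos_left hpos).ne'
  have hN : N ^ s ≤ D * u N := (Nat.pow_le_pow_left N.le_succ s).trans (h N)
  rw [neg_add_le_iff_le_add, ← Real.log_pow, ← Real.log_mul hD hu]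
  exact Real.log_le_log (by positivity) (by exact_mod_cast hN)

section SubalgebraOfMvPolynomial

open MvPolynomial

theorem finrank_restrictTotalDegree_le (σ k : Type*) [Finite σ] [Field k] (N : ℕ) :
    Module.finrank k (restrictTotalDegree σ k N) ≤ (N + 1) ^ Nat.card σ := by
  refine (Submodule.finrank_mono (restrictTotalDegree_le_restrictDegree σ (R := k) N)).trans ?_
  let φ : {a : σ →₀ ℕ | ∀ i, a i ≤ N} → (σ → Fin (N + 1)) :=
    fun a i ↦ ⟨a.1 i, Nat.lt_succ_of_le (a.2 i)⟩
  have hφ : Function.Injective φ := fun a b h ↦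
    Subtype.ext (Finsupp.ext fun i ↦ congrArg Fin.val (congrFun h i))
  have := Fintype.ofFinite σ
  rw [restrictDegree, Module.finrank_eq_nat_card_basis (basisRestrictSupport k _)]
  classical simpa using Nat.card_le_card_of_injective φ hφ

/-- The elements of total degree at most `N` of a subalgebra of a polynomial ring. -/
def totalDegreeLE {σ R : Type*} [CommRing R] (A : Subalgebra R (MvPolynomial σ R)) (N : ℕ) :
    Submodule R (MvPolynomial σ R) :=
  A.toSubmodule ⊓ restrictTotalDegree σ R N

theorem mem_totalDegreeLE {σ R : Type*} [CommRing R] {A : Subalgebra R (MvPolynomial σ R)} {N : ℕ}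
    {p : MvPolynomial σ R} : p ∈ totalDegreeLE A N ↔ p ∈ A ∧ p.totalDegree ≤ N := by
  simp [totalDegreeLE, mem_restrictTotalDegree]

theorem adjoin_range_X_eq_top {σ R : Type*} [CommRing R] (A : Subalgebra R (MvPolynomial σ R)) :
    Algebra.adjoin A (Set.range (X : σ → MvPolynomial σ R)) = ⊤ := by
  refine eq_top_iff.mpr fun p _ ↦ ?_
  induction p using MvPolynomial.induction_on with
  | C a => exact Subalgebra.algebraMap_mem _ (algebraMap R A a)
  | add p q hp hq => exact add_mem (hp trivial) (hq trivial)
  | mul_X p i hp => exact mul_mem (hp trivial) (Algebra.subset_adjoin ⟨i, rfl⟩)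

theorem totalDegreeLE_mono {σ R : Type*} [CommRing R] (A : Subalgebra R (MvPolynomial σ R)) :
    Monotone (totalDegreeLE A) := fun _ _ h _ hp ↦
  mem_totalDegreeLE.mpr ((mem_totalDegreeLE.mp hp).imp_right h.trans')

theorem exists_le_restrictTotalDegree {σ R : Type*} [CommRing R]
    {V : Submodule R (MvPolynomial σ R)} (hV : V.FG) :
    ∃ E : ℕ, V ≤ restrictTotalDegree σ R E := by
  obtain ⟨F, rfl⟩ := hV
  refine ⟨F.sup totalDegree, Submodule.span_le.mpr fun p hp ↦ ?_⟩
  exact (mem_restrictTotalDegree _ _ _).mpr (Finset.le_sup hp)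

theorem pow_le_restrictTotalDegree {σ R : Type*} [CommRing R]
    {V : Submodule R (MvPolynomial σ R)} {E : ℕ} (hE : V ≤ restrictTotalDegree σ R E) (i : ℕ) :
    V ^ i ≤ restrictTotalDegree σ R (E * i) := by
  induction i with
  | zero => simp [Submodule.one_le, mem_restrictTotalDegree]
  | succ i ih =>
    rw [pow_succ]
    refine Submodule.mul_le.mpr fun p hp q hq ↦ ?_
    have hp' := ih hp
    have hq' := hE hq
    rw [mem_restrictTotalDegree] at hp' hq' ⊢
    exact (totalDegree_mul p q).trans (add_le_add hp' hq')

variable {σ k : Type*} [Finite σ] [Field k] (A : Subalgebra k (MvPolynomial σ k))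

instance (N : ℕ) : FiniteDimensional k (totalDegreeLE A N) :=
  Submodule.finiteDimensional_inf_right _ _

theorem exists_trdeg_eq : ∃ s : ℕ, Algebra.trdeg k A = s :=
  Cardinal.lt_aleph0.mp
    ((trdeg_le_of_injective A.val Subtype.val_injective).trans_lt trdeg_lt_aleph0_of_finiteType)

theorem exists_X_comp_algebraicIndependent {s : ℕ} (hs : Algebra.trdeg k A = s) :
    ∃ (r : ℕ) (g : Fin r → σ), s + r = Nat.card σ ∧
      AlgebraicIndependent A fun i ↦ (X (g i) : MvPolynomial σ k) := by
  have : Algebra.IsAlgebraic (Algebra.adjoin A (Set.range (X : σ → MvPolynomial σ k)))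
      (MvPolynomial σ k) := ⟨fun p ↦ isAlgebraic_algebraMap
    (⟨p, adjoin_range_X_eq_top A ▸ trivial⟩ : Algebra.adjoin A (Set.range X))⟩
  obtain ⟨u, huX, hu⟩ := exists_isTranscendenceBasis_subset (R := A)
    (Set.range (X : σ → MvPolynomial σ k))
  have : Fintype u := ((Set.finite_range _).subset huX).fintype
  choose g hg using fun i ↦ huX ((Fintype.equivFin u).symm i).2
  refine ⟨Fintype.card u, g, ?_, ?_⟩
  · have := Fintype.ofFinite σ
    have h := trdeg_add_eq k A (A := MvPolynomial σ k)
    rw [← hu.cardinalMk_eq_trdeg, hs, MvPolynomial.trdeg_of_isDomain] at h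
    simp only [Cardinal.mk_fintype, Cardinal.lift_natCast] at h
    rw [Nat.card_eq_fintype_card]
    exact_mod_cast h
  · simp only [hg]
    exact hu.1.comp _ (Fintype.equivFin u).symm.injective

theorem finrank_totalDegreeLE_le {s : ℕ} (hs : Algebra.trdeg k A = s) (N : ℕ) :
    Module.finrank k (totalDegreeLE A N) ≤
      (Nat.card σ + 1) ^ Nat.card σ * (N + 1) ^ s := by
  obtain ⟨r, g, hcard, hg⟩ := exists_X_comp_algebraicIndependent A hs
  set n := Nat.card σ
  set U : Submodule k A := (totalDegreeLE A N).comap A.val.toLinearMap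
  let e : U ≃ₗ[k] totalDegreeLE A N :=
    Submodule.comapSubtypeEquivOfLe (q := A.toSubmodule) inf_le_left
  have hU : FiniteDimensional k U := e.symm.finiteDimensional
  have hmem (u : A) (hu : u ∈ U) (α : Fin r → Fin (N + 1)) :
      u • ∏ i, (X (g i) : MvPolynomial σ k) ^ (α i : ℕ) ∈ restrictTotalDegree σ k (N + r * N) := by
    rw [mem_restrictTotalDegree, Subalgebra.smul_def, smul_eq_mul]
    refine (totalDegree_mul _ _).trans (add_le_add (mem_totalDegreeLE.mp hu).2 ?_)
    calc (∏ i, (X (g i) : MvPolynomial σ k) ^ (α i : ℕ)).totalDegree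
        ≤ ∑ i, ((X (g i) : MvPolynomial σ k) ^ (α i : ℕ)).totalDegree := totalDegree_finsetProd _ _
      _ = ∑ i, (α i : ℕ) := by simp only [totalDegree_X_pow]
      _ ≤ ∑ _i : Fin r, N := Finset.sum_le_sum fun i _ ↦ Nat.lt_succ_iff.mp (α i).2
      _ = r * N := by simp
  have h : Module.finrank k (totalDegreeLE A N) * (N + 1) ^ r ≤ (N + r * N + 1) ^ n := by
    rw [← e.finrank_eq]
    simpa using (finrank_mul_card_le_finrank U (linearIndependent_prod_pow hg N) _ hmem).trans
      (finrank_restrictTotalDegree_le σ k _)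
  refine Nat.le_of_mul_le_mul_right (c := (N + 1) ^ r) ?_ (by positivity)
  calc Module.finrank k (totalDegreeLE A N) * (N + 1) ^ r
      ≤ (N + r * N + 1) ^ n := h
    _ ≤ ((n + 1) * (N + 1)) ^ n := by
        gcongr
        nlinarith [hcard.ge]
    _ = (n + 1) ^ n * (N + 1) ^ s * (N + 1) ^ r := by
        rw [mul_pow, mul_assoc, ← pow_add, hcard]

theorem exists_finrank_sumPowers_le (V : Submodule k A) [FiniteDimensional k V] :
    ∃ E : ℕ, ∀ N,
      Module.finrank k (sumPowers V N) ≤ Module.finrank k (totalDegreeLE A (E * N)) := by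
  obtain ⟨E, hE⟩ := exists_le_restrictTotalDegree
    ((Module.Finite.iff_fg.mp ‹FiniteDimensional k V›).map A.val.toLinearMap)
  refine ⟨E, fun N ↦ ?_⟩
  have hle : (sumPowers V N).map A.val.toLinearMap ≤ totalDegreeLE A (E * N) := by
    rw [Submodule.map_le_iff_le_comap, sumPowers_le_iff]
    refine fun i hi v hv ↦ mem_totalDegreeLE.mpr ⟨v.2, ?_⟩
    have hvi : (v : MvPolynomial σ k) ∈ V.map A.val.toLinearMap ^ i := by
      rw [← Submodule.map_pow]
      exact Submodule.mem_map_of_mem hv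
    have hdeg := pow_le_restrictTotalDegree hE i hvi
    rw [mem_restrictTotalDegree] at hdeg
    exact hdeg.trans (Nat.mul_le_mul_left E hi)
  have hinj : Function.Injective A.val.toLinearMap := Subtype.val_injective
  rw [(Submodule.equivMapOfInjective _ hinj _).finrank_eq]
  exact Submodule.finrank_mono hle

theorem exists_pow_le_finrank_totalDegreeLE {s : ℕ} (hs : Algebra.trdeg k A = s) :
    ∃ D : ℕ, ∀ N, (N + 1) ^ s ≤ D * Module.finrank k (totalDegreeLE A N) := by
  obtain ⟨V, hV, D, hD⟩ := exists_pow_le_finrank_sumPowers hs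
  obtain ⟨E, hE⟩ := exists_finrank_sumPowers_le A V
  refine ⟨(E + 1) ^ s * D, fun N ↦ ?_⟩
  have hEN : E * (N / (E + 1)) ≤ N :=
    (Nat.mul_le_mul_right _ E.le_succ).trans (Nat.mul_div_le N (E + 1))
  calc (N + 1) ^ s ≤ (E + 1) ^ s * (N / (E + 1) + 1) ^ s :=
        succ_pow_le_mul_succ_div_pow E.succ_pos s N
    _ ≤ (E + 1) ^ s * (D * Module.finrank k (totalDegreeLE A N)) := by
        gcongr
        exact (hD _).trans (Nat.mul_le_mul_left D ((hE _).trans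
          (Submodule.finrank_mono (totalDegreeLE_mono A hEN))))
    _ = (E + 1) ^ s * D * Module.finrank k (totalDegreeLE A N) := (mul_assoc _ _ _).symm

theorem gkDim_eq_of_trdeg_eq {s : ℕ} (hs : Algebra.trdeg k A = s) :
    gkDim k A = ((s : ℝ) : EReal) := by
  apply le_antisymm
  · refine iSup_le fun ⟨V, hV⟩ ↦ ?_
    obtain ⟨E, hE⟩ := exists_finrank_sumPowers_le A V
    set n := Nat.card σ
    refine limsup_log_div_log_le (C := (n + 1) ^ n * (E + 1) ^ s) fun N ↦ ?_
    calc Module.finrank k (sumPowers V N)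
        ≤ (n + 1) ^ n * (E * N + 1) ^ s := (hE N).trans (finrank_totalDegreeLE_le A hs _)
      _ ≤ (n + 1) ^ n * ((E + 1) * (N + 1)) ^ s := by gcongr; nlinarith
      _ = (n + 1) ^ n * (E + 1) ^ s * (N + 1) ^ s := by rw [mul_pow, mul_assoc]
  · obtain ⟨V, hV, D, hD⟩ := exists_pow_le_finrank_sumPowers hs
    exact le_iSup_of_le ⟨V, hV⟩ (le_limsup_log_div_log hD)

end SubalgebraOfMvPolynomial

end Growth

section WeightSeries

theorem exists_forall_ge_eq_of_antitone_isLowerSet {α : Type*} [Preorder α] [WellQuasiOrderedLE α]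
    {L : ℕ → Set α} (hL : ∀ j, IsLowerSet (L j)) (hanti : Antitone L) :
    ∃ J, ∀ j, J ≤ j → L j = L J := by
  by_contra! h
  have hdrop (J : ℕ) : ∃ j, J ≤ j ∧ ∃ x ∈ L J, x ∉ L j := by
    obtain ⟨j, hj, hne⟩ := h J
    exact ⟨j, hj, Set.not_subset.mp fun hs ↦ hne (Set.Subset.antisymm (hanti hj) hs)⟩
  choose next hnext x hx hxnext using hdrop
  have hmono : Monotone fun i ↦ next^[i] 0 :=
    monotone_nat_of_le_succ fun i ↦ by
      rw [Function.iterate_succ_apply']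
      exact hnext _
  obtain ⟨i, j, hij, hle⟩ := wellQuasiOrdered_le fun i ↦ x (next^[i] 0)
  refine hxnext (next^[i] 0) (hL _ hle ?_)
  rw [← Function.iterate_succ_apply' next]
  exact hanti (hmono (Nat.succ_le_of_lt hij)) (hx _)

/-- The generating function `∑ t ^ (w · a)` of a set `L` of exponent vectors `a`, counted by their
weighted degree `w · a`. -/
def weightSeries {r : ℕ} (w : Fin r → ℕ) (L : Set (Fin r → ℕ)) (t : ℝ) : ℝ :=
  ∑' a, L.indicator (fun a ↦ t ^ ∑ i, w i * a i) a

variable {r : ℕ} {t : ℝ}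

theorem summable_pow_sum_mul {w : Fin r → ℕ} (hw : ∀ i, 0 < w i) (h0 : 0 ≤ t) (h1 : t < 1) :
    Summable fun a : Fin r → ℕ ↦ t ^ ∑ i, w i * a i := by
  induction r with
  | zero => exact Summable.of_finite
  | succ r ih =>
    rw [← (Fin.consEquiv fun _ ↦ ℕ).summable_iff]
    have hgeom : Summable fun j : ℕ ↦ t ^ (w 0 * j) := by
      simp_rw [pow_mul]
      exact summable_geometric_of_lt_one (by positivity) (pow_lt_one₀ h0 h1 (hw 0).ne')
    refine (hgeom.mul_of_nonneg (ih fun i ↦ hw i.succ) (fun _ ↦ by positivity)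
      fun _ ↦ by positivity).congr fun p ↦ ?_
    simp [Fin.consEquiv, Fin.sum_univ_succ, pow_add]

theorem weightSeries_eq_tsum_slices {w : Fin (r + 1) → ℕ} (hw : ∀ i, 0 < w i)
    (L : Set (Fin (r + 1) → ℕ)) (h0 : 0 ≤ t) (h1 : t < 1) :
    weightSeries w L t = ∑' j, (t ^ w 0) ^ j *
      weightSeries (Fin.tail w) {a | (Fin.cons j a : Fin (r + 1) → ℕ) ∈ L} t := by
  have hs : Summable fun p : ℕ × (Fin r → ℕ) ↦
      L.indicator (fun a ↦ t ^ ∑ i, w i * a i) (Fin.consEquiv (fun _ ↦ ℕ) p) :=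
    (Fin.consEquiv fun _ ↦ ℕ).summable_iff.mpr ((summable_pow_sum_mul hw h0 h1).indicator L)
  rw [weightSeries, ← (Fin.consEquiv fun _ ↦ ℕ).tsum_eq, hs.tsum_prod]
  refine tsum_congr fun j ↦ ?_
  rw [weightSeries, ← tsum_mul_left]
  refine tsum_congr fun a ↦ ?_
  classical
  rw [Set.indicator_apply, Set.indicator_apply]
  simp only [Fin.consEquiv, Equiv.coe_fn_mk, Set.mem_ofPred_eq, mul_ite, mul_zero,
    Fin.sum_univ_succ, Fin.cons_zero, Fin.cons_succ, pow_add, pow_mul, Fin.tail]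

theorem tsum_pow_mul_of_forall_ge_eq {x : ℝ} (h0 : 0 ≤ x) (h1 : x < 1) {p : ℕ → ℝ} {J : ℕ}
    (hp : ∀ j, J ≤ j → p j = p J) :
    ∑' j, x ^ j * p j = ∑ j ∈ Finset.range J, x ^ j * p j + x ^ J * p J / (1 - x) := by
  have hterm (j : ℕ) : x ^ (j + J) * p (j + J) = x ^ j * (x ^ J * p J) := by
    rw [hp (j + J) (Nat.le_add_left _ _), pow_add, mul_assoc]
  have hs : Summable fun j ↦ x ^ j * p j := by
    refine (summable_nat_add_iff J).mp (Summable.congr ?_ fun j ↦ (hterm j).symm)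
    exact (summable_geometric_of_lt_one h0 h1).mul_right _
  rw [← hs.sum_add_tsum_nat_add J, tsum_congr hterm, tsum_mul_right,
    tsum_geometric_of_lt_one h0 h1, inv_mul_eq_div]

open Polynomial in
/-- The slices of `L` along the first coordinate form an antitone sequence of lower sets, which is
eventually constant by Dickson's lemma; so `weightSeries w L` is a finite sum plus a geometric
series. -/
theorem exists_weightSeries_eq_eval_div {w : Fin r → ℕ} (hw : ∀ i, 0 < w i)
    {L : Set (Fin r → ℕ)} (hL : IsLowerSet L) :
    ∃ Q : ℝ[X], ∀ t, 0 ≤ t → t < 1 → weightSeries w L t = Q.eval t / ∏ i, (1 - t ^ w i) := by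
  induction r with
  | zero =>
    refine ⟨C (weightSeries w L 0), fun t _ _ ↦ ?_⟩
    simp [weightSeries]
  | succ r ih =>
    let K : ℕ → Set (Fin r → ℕ) := fun j ↦ {a | (Fin.cons j a : Fin (r + 1) → ℕ) ∈ L}
    have hK (j : ℕ) : IsLowerSet (K j) := fun a b hba ha ↦
      hL (Fin.cons_le_cons.mpr ⟨le_rfl, hba⟩) ha
    have hanti : Antitone K := fun i j hij a ha ↦ hL (Fin.cons_le_cons.mpr ⟨hij, le_rfl⟩) ha
    obtain ⟨J, hJ⟩ := exists_forall_ge_eq_of_antitone_isLowerSet hK hanti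
    choose Q hQ using fun j ↦ ih (w := Fin.tail w) (fun i ↦ hw i.succ) (hK j)
    refine ⟨(1 - X ^ w 0) * ∑ j ∈ Finset.range J, (X ^ w 0) ^ j * Q j + (X ^ w 0) ^ J * Q J,
      fun t h0 h1 ↦ ?_⟩
    have hlt : t ^ w 0 < 1 := pow_lt_one₀ h0 h1 (hw 0).ne'
    have hslices : weightSeries w L t =
        ∑ j ∈ Finset.range J, (t ^ w 0) ^ j * weightSeries (Fin.tail w) (K j) t +
          (t ^ w 0) ^ J * weightSeries (Fin.tail w) (K J) t / (1 - t ^ w 0) :=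
      (weightSeries_eq_tsum_slices hw L h0 h1).trans <|
        tsum_pow_mul_of_forall_ge_eq (by positivity) hlt fun j hj ↦
          congrArg (weightSeries _ · t) (hJ j hj)
    simp_rw [hslices, hQ _ t h0 h1, mul_div_assoc', ← Finset.sum_div]
    simp only [Fin.prod_univ_succ, eval_add, eval_mul, eval_sub, eval_one, eval_pow, eval_X,
      eval_finsetSum, Fin.tail]
    rw [add_div, mul_div_mul_left _ _ (sub_pos.mpr hlt).ne', div_div, mul_comm (∏ i, _)]

theorem weightSeries_eq_tsum_card_mul {w : Fin r → ℕ} (hw : ∀ i, 0 < w i)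
    (L : Set (Fin r → ℕ)) (h0 : 0 ≤ t) (h1 : t < 1) :
    weightSeries w L t =
      ∑' j, (Nat.card {a : Fin r → ℕ // a ∈ L ∧ ∑ i, w i * a i = j} : ℝ) * t ^ j := by
  have hs : Summable fun a : L ↦ t ^ ∑ i, w i * a.1 i :=
    (summable_pow_sum_mul hw h0 h1).subtype L
  rw [weightSeries, ← tsum_subtype L fun a : Fin r → ℕ ↦ t ^ ∑ i, w i * a i,
    ← (hs.hasSum.tsum_fiberwise fun a : L ↦ ∑ i, w i * a.1 i).tsum_eq]
  refine tsum_congr fun j ↦ ?_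
  have hfiber (b : (fun a : L ↦ ∑ i, w i * a.1 i) ⁻¹' {j}) : t ^ ∑ i, w i * b.1.1 i = t ^ j := by
    rw [show ∑ i, w i * b.1.1 i = j from b.2]
  rw [tsum_congr hfiber, tsum_const, nsmul_eq_mul]
  congr 2
  exact Nat.card_congr (Equiv.subtypeSubtypeEquivSubtypeInter (· ∈ L) fun a ↦ ∑ i, w i * a i = j)

end WeightSeries

section GrowthSeries

variable {a : ℕ → ℕ} {s C : ℕ} {t : ℝ}

theorem succ_pow_le_factorial_mul_choose (s N : ℕ) :
    (N + 1) ^ s ≤ s.factorial * (N + s).choose s := by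
  rw [← Nat.ascFactorial_eq_factorial_mul_choose]
  exact Nat.pow_succ_le_ascFactorial (N + 1) s

theorem summable_sum_range_mul_pow
    (hC : ∀ N, ∑ i ∈ Finset.range (N + 1), a i ≤ C * (N + 1) ^ s) (h0 : 0 ≤ t) (h1 : t < 1) :
    Summable fun N ↦ ((∑ i ∈ Finset.range (N + 1), a i : ℕ) : ℝ) * t ^ N := by
  have hs := (summable_choose_mul_geometric_of_norm_lt_one s (r := t)
    (by rwa [Real.norm_of_nonneg h0])).mul_left ((C * s.factorial : ℕ) : ℝ)
  refine hs.of_nonneg_of_le (fun N ↦ by positivity) fun N ↦ ?_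
  rw [← mul_assoc]
  gcongr
  rw [← Nat.cast_mul, Nat.cast_le, mul_assoc]
  exact (hC N).trans (Nat.mul_le_mul_left _ (succ_pow_le_factorial_mul_choose s N))

theorem summable_mul_pow
    (hC : ∀ N, ∑ i ∈ Finset.range (N + 1), a i ≤ C * (N + 1) ^ s) (h0 : 0 ≤ t) (h1 : t < 1) :
    Summable fun N ↦ (a N : ℝ) * t ^ N := by
  refine (summable_sum_range_mul_pow hC h0 h1).of_nonneg_of_le (fun N ↦ by positivity) fun N ↦ ?_
  gcongr
  exact Finset.single_le_sum (f := a) (fun _ _ ↦ Nat.zero_le _) (Finset.self_mem_range_succ N)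

theorem tsum_mul_pow_eq
    (hC : ∀ N, ∑ i ∈ Finset.range (N + 1), a i ≤ C * (N + 1) ^ s) (h0 : 0 ≤ t) (h1 : t < 1) :
    ∑' N, (a N : ℝ) * t ^ N =
      (1 - t) * ∑' N, ((∑ i ∈ Finset.range (N + 1), a i : ℕ) : ℝ) * t ^ N := by
  have hsum := summable_sum_range_mul_pow hC h0 h1
  rw [sub_mul, one_mul, ← tsum_mul_left, hsum.tsum_eq_zero_add, add_sub_assoc,
    ← ((summable_nat_add_iff 1).mpr hsum).tsum_sub (hsum.mul_left t),
    (summable_mul_pow hC h0 h1).tsum_eq_zero_add]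
  simp only [zero_add, Finset.range_one, Finset.sum_singleton]
  congr 1
  refine tsum_congr fun N ↦ ?_
  rw [Finset.sum_range_succ _ (N + 1)]
  push_cast
  ring

theorem one_le_mul_one_sub_pow_mul_tsum {D : ℕ}
    (hC : ∀ N, ∑ i ∈ Finset.range (N + 1), a i ≤ C * (N + 1) ^ s)
    (hD : ∀ N, (N + 1) ^ s ≤ D * ∑ i ∈ Finset.range (N + 1), a i) (h0 : 0 ≤ t) (h1 : t < 1) :
    1 ≤ D * ((1 - t) ^ s * ∑' N, (a N : ℝ) * t ^ N) := by
  have hsum := hasSum_choose_mul_geometric_of_norm_lt_one s (r := t)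
    (by rwa [Real.norm_of_nonneg h0])
  have hle : ∑' N, ((N + s).choose s : ℝ) * t ^ N ≤
      ∑' N, (D : ℝ) * (((∑ i ∈ Finset.range (N + 1), a i : ℕ) : ℝ) * t ^ N) := by
    refine hsum.summable.tsum_le_tsum (fun N ↦ ?_)
      ((summable_sum_range_mul_pow hC h0 h1).mul_left _)
    rw [← mul_assoc]
    gcongr
    exact_mod_cast (Nat.choose_add_le_add_one_pow N s).trans (hD N)
  rw [hsum.tsum_eq, tsum_mul_left, div_le_iff₀ (pow_pos (sub_pos.mpr h1) _)] at hle
  refine hle.trans_eq ?_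
  rw [tsum_mul_pow_eq hC h0 h1]
  ring

theorem one_sub_pow_mul_tsum_le
    (hC : ∀ N, ∑ i ∈ Finset.range (N + 1), a i ≤ C * (N + 1) ^ s) (h0 : 0 ≤ t) (h1 : t < 1) :
    (1 - t) ^ s * ∑' N, (a N : ℝ) * t ^ N ≤ C * s.factorial := by
  have hsum := hasSum_choose_mul_geometric_of_norm_lt_one s (r := t)
    (by rwa [Real.norm_of_nonneg h0])
  have hle : ∑' N, ((∑ i ∈ Finset.range (N + 1), a i : ℕ) : ℝ) * t ^ N ≤
      ∑' N, ((C * s.factorial : ℕ) : ℝ) * (((N + s).choose s : ℝ) * t ^ N) := by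
    refine (summable_sum_range_mul_pow hC h0 h1).tsum_le_tsum (fun N ↦ ?_)
      (hsum.summable.mul_left _)
    rw [← mul_assoc]
    gcongr
    rw [← Nat.cast_mul, Nat.cast_le, mul_assoc]
    exact (hC N).trans (Nat.mul_le_mul_left _ (succ_pow_le_factorial_mul_choose s N))
  rw [tsum_mul_left, hsum.tsum_eq, mul_one_div, le_div_iff₀ (pow_pos (sub_pos.mpr h1) _),
    Nat.cast_mul] at hle
  rw [tsum_mul_pow_eq hC h0 h1]
  exact hle.trans_eq' (by ring)

end GrowthSeries

section PoleOrder

theorem exists_tendsto_pos_of_meromorphicAt {f : ℝ → ℝ} {x c C : ℝ} (hf : MeromorphicAt f x)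
    (hc : 0 < c) (hlo : ∀ᶠ t in 𝓝[<] x, c ≤ f t) (hhi : ∀ᶠ t in 𝓝[<] x, f t ≤ C) :
    ∃ l, 0 < l ∧ Tendsto f (𝓝[<] x) (𝓝 l) := by
  have hsub : 𝓝[<] x ≤ 𝓝[≠] x := nhdsWithin_mono x fun _ ht ↦ ne_of_lt ht
  suffices ∃ l, Tendsto f (𝓝[<] x) (𝓝 l) by
    obtain ⟨l, hl⟩ := this
    exact ⟨l, hc.trans_le (ge_of_tendsto hl hlo), hl⟩
  by_cases ho : 0 ≤ meromorphicOrderAt f x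
  · obtain ⟨l, hl⟩ := tendsto_nhds_of_meromorphicOrderAt_nonneg hf ho
    exact ⟨l, hl.mono_left hsub⟩
  · have habs := tendsto_norm_cobounded_atTop.comp
      ((tendsto_cobounded_of_meromorphicOrderAt_neg (not_le.mp ho)).mono_left hsub)
    obtain ⟨t, ht, hlo, hhi⟩ := ((habs.eventually_gt_atTop C).and (hlo.and hhi)).exists
    rw [Function.comp_apply, Real.norm_of_nonneg (hc.le.trans hlo)] at ht
    exact absurd hhi ht.not_ge

variable {k A : Type*} [Field k] [CommRing A] [Algebra k A] {𝒜 : ℕ → Submodule k A}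

theorem isLeast_poleExponents {s : ℕ} {l : ℝ} (hl : 0 < l)
    (h : Tendsto (fun t ↦ (1 - t) ^ s * poincareSeries 𝒜 t) (𝓝[<] 1) (𝓝 l)) :
    IsLeast (poleExponents 𝒜) s := by
  refine ⟨⟨l, h⟩, fun e ⟨l', he⟩ ↦ ?_⟩
  by_contra! hlt
  have hzero : Tendsto (fun t : ℝ ↦ (1 - t) ^ (s - e)) (𝓝[<] 1) (𝓝 0) := by
    have : Tendsto (fun t : ℝ ↦ (1 - t) ^ (s - e)) (𝓝 1) (𝓝 ((1 - 1) ^ (s - e))) :=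
      Continuous.tendsto (by fun_prop) 1
    rw [sub_self, zero_pow (Nat.sub_pos_of_lt hlt).ne'] at this
    exact this.mono_left nhdsWithin_le_nhds
  refine hl.ne' (tendsto_nhds_unique h ?_)
  simpa only [← mul_assoc, ← pow_add, Nat.sub_add_cancel hlt.le, zero_mul] using hzero.mul he

theorem one_le_poincareRadius {s C : ℕ}
    (hC : ∀ N, ∑ i ∈ Finset.range (N + 1), Module.finrank k (𝒜 i) ≤ C * (N + 1) ^ s) :
    1 ≤ poincareRadius 𝒜 := by
  refine ENNReal.le_of_forall_nnreal_lt fun x hx ↦ ?_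
  refine FormalMultilinearSeries.le_radius_of_summable _ ?_
  refine (summable_mul_pow hC x.2 (by exact_mod_cast hx)).of_nonneg_of_le
    (fun N ↦ by positivity) fun N ↦ ?_
  simp

/-- Since `P` is rational, `(1 - t) ^ s * P(t)` is meromorphic at `1`; as the growth of the partial
sums keeps it away from `0` and `∞`, it has a nonzero limit. -/
theorem isLeast_poleExponents_of_growth {s C D : ℕ} {P : ℝ → ℝ} (hP : MeromorphicAt P 1)
    (heq : ∀ t, 0 ≤ t → t < 1 → poincareSeries 𝒜 t = P t)
    (hC : ∀ N, ∑ i ∈ Finset.range (N + 1), Module.finrank k (𝒜 i) ≤ C * (N + 1) ^ s)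
    (hD : ∀ N, (N + 1) ^ s ≤ D * ∑ i ∈ Finset.range (N + 1), Module.finrank k (𝒜 i)) :
    IsLeast (poleExponents 𝒜) s := by
  have hI : ∀ᶠ t in 𝓝[<] (1 : ℝ), t ∈ Set.Ioo (0 : ℝ) 1 := Ioo_mem_nhdsLT one_pos
  have hDpos : (0 : ℝ) < D := by
    have := hD 0
    rw [zero_add, one_pow] at this
    exact_mod_cast Nat.pos_of_mul_pos_right this
  obtain ⟨l, hl, hlim⟩ := exists_tendsto_pos_of_meromorphicAt
    (f := fun t ↦ (1 - t) ^ s * P t) (c := (D : ℝ)⁻¹) (C := C * s.factorial)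
    (by fun_prop) (inv_pos.mpr hDpos)
    (hI.mono fun t ht ↦ by
      rw [inv_le_iff_one_le_mul₀' hDpos, ← heq t ht.1.le ht.2]
      exact one_le_mul_one_sub_pow_mul_tsum hC hD ht.1.le ht.2)
    (hI.mono fun t ht ↦ by
      rw [← heq t ht.1.le ht.2]
      exact one_sub_pow_mul_tsum_le hC ht.1.le ht.2)
  refine isLeast_poleExponents hl (hlim.congr' (hI.mono fun t ht ↦ ?_))
  simp only [heq t ht.1.le ht.2]

end PoleOrder

section WeightedGraded

open MvPolynomial

variable {σ τ R : Type*} [CommRing R]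

/-- A space of polynomials is graded for the weights `w` of the variables if it contains the
weighted homogeneous components of its elements. A graded subalgebra for the total degree is the
case `w = 1`. -/
def IsWeightedGraded (w : σ → ℕ) (V : Submodule R (MvPolynomial σ R)) : Prop :=
  ∀ f ∈ V, ∀ j, weightedHomogeneousComponent w j f ∈ V

variable {w : τ → ℕ} {f : τ → MvPolynomial σ R}

theorem isHomogeneous_aeval (hf : ∀ i, (f i).IsHomogeneous (w i)) {p : MvPolynomial τ R} {j : ℕ}
    (hp : p.IsWeightedHomogeneous w j) : (aeval f p).IsHomogeneous j := by
  rw [aeval_def, eval₂_eq]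
  refine IsHomogeneous.sum _ _ _ fun d hd ↦ ?_
  rw [algebraMap_eq, ← hp (mem_support_iff.mp hd), Finsupp.weight_apply, Finsupp.sum,
    ← zero_add (∑ i ∈ d.support, _)]
  refine (isHomogeneous_C _ _).mul (IsHomogeneous.prod _ _ _ fun i _ ↦ ?_)
  rw [smul_eq_mul, mul_comm]
  exact (hf i).pow (d i)

theorem homogeneousComponent_aeval (hf : ∀ i, (f i).IsHomogeneous (w i))
    (p : MvPolynomial τ R) (j : ℕ) :
    homogeneousComponent j (aeval f p) = aeval f (weightedHomogeneousComponent w j p) := by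
  induction p using MvPolynomial.induction_on' with
  | monomial d c =>
    have hd := isWeightedHomogeneous_monomial w d c rfl
    rw [homogeneousComponent_of_mem (isHomogeneous_aeval hf hd),
      weightedHomogeneousComponent_of_mem hd, apply_ite (aeval f), map_zero]
  | add p q hp hq => rw [map_add, map_add, hp, hq, map_add, map_add]

theorem isWeightedGraded_ker_aeval (hf : ∀ i, (f i).IsHomogeneous (w i)) :
    IsWeightedGraded w ((RingHom.ker (aeval f : MvPolynomial τ R →ₐ[R] _)).restrictScalars R) := by
  intro p hp j
  rw [Submodule.restrictScalars_mem, RingHom.mem_ker] at hp ⊢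
  rw [← homogeneousComponent_aeval hf, hp, map_zero]

theorem isWeightedGraded_adjoin_range (hf : ∀ i, (f i).IsHomogeneous (w i)) :
    IsWeightedGraded 1 (Algebra.adjoin R (Set.range f)).toSubmodule := by
  intro p hp j
  rw [Subalgebra.mem_toSubmodule, Algebra.adjoin_range_eq_range_aeval] at hp ⊢
  obtain ⟨q, rfl⟩ := hp
  exact ⟨_, (homogeneousComponent_aeval hf q j).symm⟩

theorem map_aeval_weightedHomogeneousSubmodule (hf : ∀ i, (f i).IsHomogeneous (w i)) (j : ℕ) :
    (weightedHomogeneousSubmodule R w j).map (aeval f).toLinearMap =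
      (Algebra.adjoin R (Set.range f)).toSubmodule ⊓ homogeneousSubmodule σ R j := by
  rw [Algebra.adjoin_range_eq_range_aeval]
  ext p
  constructor
  · rintro ⟨q, hq, rfl⟩
    exact ⟨⟨q, rfl⟩, isHomogeneous_aeval hf hq⟩
  · rintro ⟨⟨q, rfl⟩, hp⟩
    refine ⟨_, weightedHomogeneousComponent_isWeightedHomogeneous j q, ?_⟩
    rw [AlgHom.toLinearMap_apply, ← homogeneousComponent_aeval hf]
    exact (homogeneousComponent_of_mem hp).trans (if_pos rfl)

end WeightedGraded

section DegreeSet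

open MvPolynomial

variable {σ R : Type*} [CommRing R] (m : MonomialOrder σ)

/-- The exponents of the leading terms of the nonzero elements of a space of polynomials. -/
def degreeSet (V : Submodule R (MvPolynomial σ R)) : Set (σ →₀ ℕ) :=
  {γ | ∃ f ∈ V, f ≠ 0 ∧ m.degree f = γ}

variable {m} in
theorem degree_mem_degreeSet {V : Submodule R (MvPolynomial σ R)} {f : MvPolynomial σ R}
    (hf : f ∈ V) (h0 : f ≠ 0) : m.degree f ∈ degreeSet m V :=
  ⟨f, hf, h0, rfl⟩

theorem degreeSet_inf_weightedHomogeneousSubmodule {w : σ → ℕ}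
    {V : Submodule R (MvPolynomial σ R)} (hV : IsWeightedGraded w V) (j : ℕ) :
    degreeSet m (V ⊓ weightedHomogeneousSubmodule R w j) =
      degreeSet m V ∩ {γ | Finsupp.weight w γ = j} := by
  ext γ
  constructor
  · rintro ⟨f, ⟨hf, hfj⟩, hf0, rfl⟩
    exact ⟨degree_mem_degreeSet hf hf0, hfj (m.coeff_degree_ne_zero_iff.mpr hf0)⟩
  · rintro ⟨⟨f, hf, hf0, rfl⟩, hj : Finsupp.weight w _ = j⟩
    set g := weightedHomogeneousComponent w j f
    have hcoeff : g.coeff (m.degree f) ≠ 0 := by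
      rw [coeff_weightedHomogeneousComponent, if_pos hj]
      exact m.coeff_degree_ne_zero_iff.mpr hf0
    refine ⟨g, ⟨hV f hf j, weightedHomogeneousComponent_isWeightedHomogeneous j f⟩,
      fun h ↦ hcoeff (by rw [h, coeff_zero]), m.toSyn.injective (le_antisymm ?_ ?_)⟩
    · refine m.degree_le_degree_of_support_subset ?_
      rw [support_weightedHomogeneousComponent]
      exact Finset.filter_subset _ _
    · exact m.le_degree (mem_support_iff.mpr hcoeff)

theorem degreeSet_top [Nontrivial R] :
    degreeSet m (⊤ : Submodule R (MvPolynomial σ R)) = Set.univ := by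
  classical
  exact Set.eq_univ_of_forall fun γ ↦ ⟨monomial γ 1, trivial, by simp, by
    rw [m.degree_monomial, if_neg one_ne_zero]⟩

theorem isUpperSet_degreeSet [IsDomain R] (I : Ideal (MvPolynomial σ R)) :
    IsUpperSet (degreeSet m (I.restrictScalars R)) := by
  classical
  rintro _ _ hle ⟨f, hf, hf0, rfl⟩
  obtain ⟨δ, rfl⟩ := exists_add_of_le hle
  have h0 : (monomial δ 1 : MvPolynomial σ R) ≠ 0 := by simp
  refine ⟨f * monomial δ 1, I.mul_mem_right _ hf, mul_ne_zero hf0 h0, ?_⟩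
  rw [m.degree_mul hf0 h0, m.degree_monomial, if_neg one_ne_zero]

theorem linearIndependent_of_injective_degree [NoZeroDivisors R] {ι : Type*}
    {v : ι → MvPolynomial σ R} (hv : ∀ i, v i ≠ 0)
    (hdeg : Function.Injective fun i ↦ m.degree (v i)) :
    LinearIndependent R v := by
  rw [linearIndependent_iff]
  intro l hl
  by_contra hne
  obtain ⟨i, hi, hmax⟩ := Finset.exists_max_image l.support (fun i ↦ m.toSyn (m.degree (v i)))
    (Finsupp.support_nonempty_iff.mpr hne)
  have hcoeff : l i * (v i).coeff (m.degree (v i)) = 0 := by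
    have hsum : (Finsupp.linearCombination R v l).coeff (m.degree (v i)) = 0 := by
      rw [hl, coeff_zero]
    rw [Finsupp.linearCombination_apply, Finsupp.sum, coeff_sum] at hsum
    rw [← smul_eq_mul, ← coeff_smul, ← hsum]
    symm
    refine Finset.sum_eq_single_of_mem i hi fun j hj hji ↦ ?_
    rw [coeff_smul, m.coeff_eq_zero_of_lt, smul_zero]
    exact lt_of_le_of_ne (hmax j hj) fun h ↦ hji (hdeg (m.toSyn.injective h))
  exact mul_ne_zero (Finsupp.mem_support_iff.mp hi)
    (m.coeff_degree_ne_zero_iff.mpr (hv i)) hcoeff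

variable {k : Type*} [Field k]

theorem le_span_of_degreeSet_subset_range {ι : Type*} {V : Submodule k (MvPolynomial σ k)}
    {v : ι → MvPolynomial σ k} (hvV : ∀ i, v i ∈ V) (hv : ∀ i, v i ≠ 0)
    (hdeg : degreeSet m V ⊆ Set.range fun i ↦ m.degree (v i)) :
    V ≤ Submodule.span k (Set.range v) := by
  intro p hp
  induction p using (InvImage.wf (fun p : MvPolynomial σ k ↦ m.toSyn (m.degree p))
    wellFounded_lt).induction with
  | _ p ih =>
    by_cases hp0 : p = 0
    · rw [hp0]
      exact zero_mem _
    obtain ⟨i, hi⟩ := hdeg (degree_mem_degreeSet hp hp0)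
    dsimp only at hi
    have hc : (v i).coeff (m.degree p) ≠ 0 := hi ▸ m.coeff_degree_ne_zero_iff.mpr (hv i)
    set c := p.coeff (m.degree p) / (v i).coeff (m.degree p)
    have hmem : c • v i ∈ Submodule.span k (Set.range v) :=
      Submodule.smul_mem _ _ (Submodule.subset_span ⟨i, rfl⟩)
    rw [← Submodule.sub_mem_iff_left _ hmem]
    by_cases hq0 : p - c • v i = 0
    · rw [hq0]
      exact zero_mem _
    refine ih _ (lt_of_le_of_ne ?_ fun heq ↦ ?_) (V.sub_mem hp (V.smul_mem c (hvV i)))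
    · exact m.degree_sub_le.trans (max_le le_rfl (m.degree_smul_le.trans_eq (by rw [hi])))
    · refine m.coeff_degree_ne_zero_iff.mpr hq0 ?_
      rw [m.toSyn.injective heq, coeff_sub, coeff_smul, smul_eq_mul, div_mul_cancel₀ _ hc,
        sub_self]

theorem finrank_eq_ncard_degreeSet (V : Submodule k (MvPolynomial σ k)) :
    Module.finrank k V = (degreeSet m V).ncard := by
  choose v hvV hv0 hv using fun γ : degreeSet m V ↦ γ.2
  have hli : LinearIndependent k v := linearIndependent_of_injective_degree m hv0 fun γ δ h ↦
    Subtype.ext ((hv γ).symm.trans (h.trans (hv δ)))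
  have hspan : Submodule.span k (Set.range v) = V :=
    le_antisymm (Submodule.span_le.mpr (Set.range_subset_iff.mpr hvV))
      (le_span_of_degreeSet_subset_range m hvV hv0 fun γ hγ ↦ ⟨⟨γ, hγ⟩, hv _⟩)
  rw [← Nat.card_coe_set_eq, ← Module.finrank_eq_nat_card_basis (Module.Basis.span hli), hspan]

end DegreeSet

section Presentation

open MvPolynomial

theorem finrank_map_add_finrank_ker_inf {k V₁ V₂ : Type*} [DivisionRing k] [AddCommGroup V₁]
    [AddCommGroup V₂] [Module k V₁] [Module k V₂] (φ : V₁ →ₗ[k] V₂) (W : Submodule k V₁)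
    [FiniteDimensional k W] :
    Module.finrank k (W.map φ) + Module.finrank k (LinearMap.ker φ ⊓ W : Submodule k V₁) =
      Module.finrank k W := by
  rw [← LinearMap.finrank_range_add_finrank_ker (φ.domRestrict W), LinearMap.range_domRestrict,
    LinearMap.ker_domRestrict, inf_comm, ← Submodule.map_comap_subtype,
    LinearEquiv.finrank_eq (Submodule.equivSubtypeMap _ _)]

variable {σ τ k : Type*} [Field k] [Finite τ] {w : τ → ℕ} {f : τ → MvPolynomial σ k}

theorem finrank_adjoin_range_inf_homogeneousSubmodule (m : MonomialOrder τ)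
    (hf : ∀ i, (f i).IsHomogeneous (w i)) (hw : ∀ i, w i ≠ 0) (j : ℕ) :
    Module.finrank k ((Algebra.adjoin k (Set.range f)).toSubmodule ⊓ homogeneousSubmodule σ k j :
        Submodule k (MvPolynomial σ k)) =
      ({γ | Finsupp.weight w γ = j} \ degreeSet m
        ((RingHom.ker (aeval f : MvPolynomial τ k →ₐ[k] _)).restrictScalars k)).ncard := by
  set φ := (aeval f : MvPolynomial τ k →ₐ[k] MvPolynomial σ k)
  set W := weightedHomogeneousSubmodule k w j
  set I := (RingHom.ker φ).restrictScalars k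
  have : FiniteDimensional k W :=
    Module.Finite.iff_fg.mpr (weightedHomogeneousSubmodule_fg k w hw j)
  have hrank := finrank_map_add_finrank_ker_inf φ.toLinearMap W
  have hcard := Set.ncard_inter_add_ncard_sdiff_eq_ncard {γ : τ →₀ ℕ | Finsupp.weight w γ = j}
    (degreeSet m I) (Finsupp.finite_of_nat_weight_eq w hw j)
  have hW : {γ : τ →₀ ℕ | Finsupp.weight w γ = j} = degreeSet m W := by
    rw [← top_inf_eq W, degreeSet_inf_weightedHomogeneousSubmodule m (V := ⊤)
      (fun _ _ _ ↦ trivial), degreeSet_top, Set.univ_inter]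
  have hI : degreeSet m (I ⊓ W) = {γ : τ →₀ ℕ | Finsupp.weight w γ = j} ∩ degreeSet m I := by
    rw [degreeSet_inf_weightedHomogeneousSubmodule m (isWeightedGraded_ker_aeval hf),
      Set.inter_comm]
  rw [← hI, hW, ← finrank_eq_ncard_degreeSet, ← finrank_eq_ncard_degreeSet, ← hW] at hcard
  rw [map_aeval_weightedHomogeneousSubmodule hf] at hrank
  change _ + Module.finrank k (I ⊓ W : Submodule k _) = _ at hrank
  lia

end Presentation

section GradedSubalgebra

open MvPolynomial

variable {k : Type*} [Field k] {n : ℕ} (A : Subalgebra k (MvPolynomial (Fin n) k))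

theorem map_val_degreePiece (i : ℕ) :
    (degreePiece A i).map A.val.toLinearMap =
      A.toSubmodule ⊓ homogeneousSubmodule (Fin n) k i := by
  ext f
  constructor
  · rintro ⟨g, hg, rfl⟩
    exact ⟨g.2, hg⟩
  · exact fun ⟨hf, hfi⟩ ↦ ⟨⟨f, hf⟩, hfi, rfl⟩

theorem finrank_degreePiece (i : ℕ) :
    Module.finrank k (degreePiece A i) =
      Module.finrank k (A.toSubmodule ⊓ homogeneousSubmodule (Fin n) k i : Submodule k _) := by
  rw [(Submodule.equivMapOfInjective A.val.toLinearMap Subtype.val_injective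
    (degreePiece A i)).finrank_eq, map_val_degreePiece]

instance (i : ℕ) : FiniteDimensional k (degreePiece A i) := by
  have hfin : FiniteDimensional k (homogeneousSubmodule (Fin n) k i) :=
    Module.Finite.iff_fg.mpr (weightedHomogeneousSubmodule_fg k 1 (fun _ ↦ one_ne_zero) i)
  have := Submodule.finiteDimensional_of_le
    ((map_val_degreePiece A i).trans_le inf_le_right : _ ≤ homogeneousSubmodule (Fin n) k i)
  exact Module.Finite.equiv (Submodule.equivMapOfInjective A.val.toLinearMap
    Subtype.val_injective (degreePiece A i)).symm

instance : SetLike.GradedMonoid (degreePiece A) where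
  one_mem := isHomogeneous_one _ _
  mul_mem _ _ _ _ hf hg := hf.mul hg

theorem degreePiece_zero : degreePiece A 0 = 1 := by
  ext f
  change (f : MvPolynomial (Fin n) k).IsHomogeneous 0 ↔ _
  rw [← totalDegree_zero_iff_isHomogeneous, totalDegree_eq_zero_iff_eq_C, Submodule.mem_one]
  constructor
  · exact fun h ↦ ⟨_, Subtype.ext h.symm⟩
  · rintro ⟨c, rfl⟩
    rw [A.coe_algebraMap, algebraMap_eq, coeff_zero_C]

variable {A}

theorem iSupIndep_degreePiece : iSupIndep (degreePiece A) := by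
  intro i
  rw [Submodule.disjoint_def]
  intro f hf hf'
  have hle : ⨆ j, ⨆ (_ : j ≠ i), degreePiece A j ≤
      LinearMap.ker ((homogeneousComponent i).comp A.val.toLinearMap) :=
    iSup₂_le fun j hj g hg ↦ (homogeneousComponent_of_mem hg).trans (if_neg hj.symm)
  exact Subtype.ext (((homogeneousComponent_of_mem hf).trans (if_pos rfl)).symm.trans (hle hf'))

theorem isInternal_degreePiece (hA : IsWeightedGraded 1 A.toSubmodule) :
    DirectSum.IsInternal (degreePiece A) := by
  refine (DirectSum.isInternal_submodule_iff_iSupIndep_and_iSup_eq_top _).mpr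
    ⟨iSupIndep_degreePiece, eq_top_iff.mpr fun f _ ↦ ?_⟩
  have hf : f = ∑ i ∈ Finset.range ((f : MvPolynomial (Fin n) k).totalDegree + 1),
      (⟨_, hA f f.2 i⟩ : A) := by
    apply Subtype.ext
    rw [AddSubmonoidClass.coe_finsetSum]
    exact (sum_homogeneousComponent _).symm
  rw [hf]
  exact Submodule.sum_mem _ fun i _ ↦ Submodule.mem_iSup_of_mem i
    (homogeneousComponent_isHomogeneous i _)

theorem map_homogeneousComponent_totalDegreeLE (hA : IsWeightedGraded 1 A.toSubmodule) (N : ℕ) :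
    (totalDegreeLE A N).map (homogeneousComponent N) =
      A.toSubmodule ⊓ homogeneousSubmodule (Fin n) k N := by
  apply le_antisymm
  · rintro _ ⟨f, hf, rfl⟩
    exact ⟨hA f hf.1 N, homogeneousComponent_isHomogeneous N f⟩
  · rintro f ⟨hf, hfN⟩
    exact ⟨f, mem_totalDegreeLE.mpr ⟨hf, IsHomogeneous.totalDegree_le hfN⟩,
      (homogeneousComponent_of_mem hfN).trans (if_pos rfl)⟩

theorem ker_homogeneousComponent_inf_totalDegreeLE (N : ℕ) :
    LinearMap.ker (homogeneousComponent (N + 1)) ⊓ totalDegreeLE A (N + 1) =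
      totalDegreeLE A N := by
  ext f
  rw [Submodule.mem_inf, LinearMap.mem_ker, mem_totalDegreeLE, mem_totalDegreeLE]
  constructor
  · rintro ⟨h0, hf, hle⟩
    refine ⟨hf, Finset.sup_le fun γ hγ ↦ Nat.le_of_lt_succ (lt_of_le_of_ne
      ((le_totalDegree hγ).trans hle) fun hdeg ↦ mem_support_iff.mp hγ ?_)⟩
    have hcoeff := coeff_homogeneousComponent (N + 1) f γ
    rwa [if_pos (by rwa [Finsupp.degree_apply]), h0, coeff_zero, eq_comm] at hcoeff
  · rintro ⟨hf, hle⟩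
    exact ⟨homogeneousComponent_eq_zero _ _ (Nat.lt_succ_of_le hle), hf, hle.trans N.le_succ⟩

theorem finrank_totalDegreeLE (hA : IsWeightedGraded 1 A.toSubmodule) (N : ℕ) :
    Module.finrank k (totalDegreeLE A N) =
      ∑ i ∈ Finset.range (N + 1), Module.finrank k (degreePiece A i) := by
  induction N with
  | zero =>
    have h0 : A.toSubmodule ⊓ homogeneousSubmodule (Fin n) k 0 = totalDegreeLE A 0 := by
      ext f
      rw [mem_totalDegreeLE, Nat.le_zero, totalDegree_zero_iff_isHomogeneous]
      rfl
    rw [zero_add, Finset.sum_range_one, finrank_degreePiece, h0]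
  | succ N ih =>
    rw [Finset.sum_range_succ, ← ih, finrank_degreePiece,
      ← map_homogeneousComponent_totalDegreeLE hA,
      ← ker_homogeneousComponent_inf_totalDegreeLE N,
      add_comm (Module.finrank k _), finrank_map_add_finrank_ker_inf]

theorem isHilbertSerre_and_hilbertSerreDim_eq (hA : IsWeightedGraded 1 A.toSubmodule) {s : ℕ}
    (hs : Algebra.trdeg k A = s) {P : ℝ → ℝ} (hP : MeromorphicAt P 1)
    (heq : ∀ t, 0 ≤ t → t < 1 → poincareSeries (degreePiece A) t = P t) :
    IsHilbertSerre (degreePiece A) ∧ hilbertSerreDim (degreePiece A) = s := by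
  have hC := finrank_totalDegreeLE_le A hs
  obtain ⟨D, hD⟩ := exists_pow_le_finrank_totalDegreeLE A hs
  simp_rw [finrank_totalDegreeLE hA] at hC hD
  have hleast := isLeast_poleExponents_of_growth hP heq hC hD
  exact ⟨⟨inferInstance, isInternal_degreePiece hA, FaithfulSMul.algebraMap_injective k A,
    degreePiece_zero A, inferInstance, one_le_poincareRadius hC, hleast.nonempty⟩,
    hleast.csInf_eq⟩

end GradedSubalgebra

section Rationality

open MvPolynomial

variable {k : Type*} [Field k] {n r : ℕ} {w : Fin r → ℕ} {f : Fin r → MvPolynomial (Fin n) k}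

theorem exists_meromorphicAt_poincareSeries_adjoin_range_eq (hf : ∀ i, (f i).IsHomogeneous (w i))
    (hw : ∀ i, 0 < w i) : ∃ P : ℝ → ℝ, MeromorphicAt P 1 ∧ ∀ t, 0 ≤ t → t < 1 →
      poincareSeries (degreePiece (Algebra.adjoin k (Set.range f))) t = P t := by
  set E := degreeSet MonomialOrder.lex
    ((RingHom.ker (aeval f : MvPolynomial (Fin r) k →ₐ[k] _)).restrictScalars k)
  have hE : IsLowerSet (Finsupp.equivFunOnFinite.symm ⁻¹' Eᶜ) :=
    (isUpperSet_degreeSet _ _).compl.preimage fun _ _ h ↦ h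
  obtain ⟨Q, hQ⟩ := exists_weightSeries_eq_eval_div hw hE
  have hQan : AnalyticAt ℝ (fun t ↦ Q.eval t) 1 :=
    AnalyticOnNhd.eval_polynomial (𝕜 := ℝ) Q 1 trivial
  refine ⟨fun t ↦ Q.eval t / ∏ i, (1 - t ^ w i), hQan.meromorphicAt.div (by fun_prop),
    fun t h0 h1 ↦ ?_⟩
  dsimp only
  rw [← hQ t h0 h1, weightSeries_eq_tsum_card_mul hw _ h0 h1, poincareSeries]
  refine tsum_congr fun j ↦ ?_
  rw [finrank_degreePiece, finrank_adjoin_range_inf_homogeneousSubmodule MonomialOrder.lex hf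
    fun i ↦ (hw i).ne', ← Nat.card_coe_set_eq]
  congr 2
  refine Nat.card_congr (Finsupp.equivFunOnFinite.subtypeEquiv fun γ ↦ ?_)
  rw [Set.mem_preimage, Equiv.symm_apply_apply, Set.mem_compl_iff, Set.mem_sdiff, and_comm,
    Set.mem_ofPred_eq, Finsupp.weight_apply, Finsupp.sum_fintype _ _ fun i ↦ zero_smul ℕ (w i)]
  simp only [smul_eq_mul, mul_comm, Finsupp.equivFunOnFinite_apply]
  rfl

end Rationality

theorem IsFGHomogeneous.exists_generators {k : Type*} [Field k] {n : ℕ}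
    {S : Subalgebra k (MvPolynomial (Fin n) k)} (hS : IsFGHomogeneous S) :
    ∃ (r : ℕ) (f : Fin r → MvPolynomial (Fin n) k) (w : Fin r → ℕ),
      (∀ i, (f i).IsHomogeneous (w i)) ∧ (∀ i, 0 < w i) ∧ S = Algebra.adjoin k (Set.range f) := by
  classical
  obtain ⟨F, hF, rfl⟩ := hS
  set G := F.filter fun p ↦ p.totalDegree ≠ 0
  have hG (p : G) : p.1 ∈ F ∧ p.1.totalDegree ≠ 0 := Finset.mem_filter.mp p.2
  refine ⟨G.card, fun i ↦ G.equivFin.symm i, fun i ↦ (G.equivFin.symm i).1.totalDegree,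
    fun i ↦ ?_, fun i ↦ Nat.pos_of_ne_zero (hG _).2, ?_⟩
  · obtain ⟨e, he⟩ := hF _ (hG (G.equivFin.symm i)).1
    dsimp only
    rwa [he.totalDegree fun h0 ↦ (hG (G.equivFin.symm i)).2 (by simp [h0])]
  · have hrange : Set.range (fun i ↦ (G.equivFin.symm i : MvPolynomial (Fin n) k)) = G := by
      rw [← Subtype.range_coe (s := (G : Set (MvPolynomial (Fin n) k)))]
      exact G.equivFin.symm.surjective.range_comp Subtype.val
    rw [hrange]
    refine le_antisymm (Algebra.adjoin_le fun p hp ↦ ?_)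
      (Algebra.adjoin_mono (Finset.coe_subset.mpr (Finset.filter_subset _ _)))
    by_cases h : p.totalDegree = 0
    · rw [MvPolynomial.totalDegree_eq_zero_iff_eq_C.mp h]
      exact Subalgebra.algebraMap_mem _ _
    · exact Algebra.subset_adjoin (Finset.mem_coe.mpr (Finset.mem_filter.mpr ⟨hp, h⟩))

section InitialAlgebra

open MvPolynomial

variable {k : Type*} [Field k] {n : ℕ} {m : MonomialOrder (Fin n)}
  {S : Subalgebra k (MvPolynomial (Fin n) k)}

theorem monomial_mem_initialAlgebra {γ : Fin n →₀ ℕ} (hγ : γ ∈ degreeSet m S.toSubmodule) (c : k) :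
    monomial γ c ∈ initialAlgebra m S := by
  obtain ⟨f, hf, h0, rfl⟩ := hγ
  have h : monomial (m.degree f) c = (c / m.leadingCoeff f) • m.leadingTerm f := by
    rw [MonomialOrder.leadingTerm, smul_monomial, smul_eq_mul,
      div_mul_cancel₀ _ (m.leadingCoeff_ne_zero_iff.mpr h0)]
  rw [h]
  exact Subalgebra.smul_mem _ (Algebra.subset_adjoin (Set.mem_image_of_mem _ hf)) _

theorem zero_mem_degreeSet_toSubmodule : 0 ∈ degreeSet m S.toSubmodule :=
  ⟨1, one_mem S, one_ne_zero, m.degree_one⟩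

theorem add_mem_degreeSet_toSubmodule {α β : Fin n →₀ ℕ} (hα : α ∈ degreeSet m S.toSubmodule)
    (hβ : β ∈ degreeSet m S.toSubmodule) : α + β ∈ degreeSet m S.toSubmodule := by
  obtain ⟨f, hf, hf0, rfl⟩ := hα
  obtain ⟨g, hg, hg0, rfl⟩ := hβ
  exact ⟨f * g, S.mul_mem hf hg, mul_ne_zero hf0 hg0, m.degree_mul hf0 hg0⟩

theorem mem_initialAlgebra_iff {p : MvPolynomial (Fin n) k} :
    p ∈ initialAlgebra m S ↔ ∀ γ ∈ p.support, γ ∈ degreeSet m S.toSubmodule := by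
  classical
  constructor
  · intro hp
    induction hp using Algebra.adjoin_induction with
    | mem p hp =>
      obtain ⟨f, hf, rfl⟩ := hp
      intro γ hγ
      have h0 : f ≠ 0 := fun h ↦ by simp [h] at hγ
      rw [m.support_leadingTerm' h0, Finset.mem_singleton] at hγ
      exact hγ ▸ degree_mem_degreeSet hf h0
    | algebraMap c =>
      intro γ hγ
      rw [Finset.mem_singleton.mp (support_monomial_subset hγ)]
      exact zero_mem_degreeSet_toSubmodule
    | add p q _ _ hp hq =>
      exact fun γ hγ ↦ (Finset.mem_union.mp (support_add hγ)).elim (hp γ) (hq γ)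
    | mul p q _ _ hp hq =>
      intro γ hγ
      obtain ⟨α, hα, β, hβ, rfl⟩ := Finset.mem_add.mp (support_mul p q hγ)
      exact add_mem_degreeSet_toSubmodule (hp α hα) (hq β hβ)
  · intro h
    rw [p.as_sum]
    exact sum_mem fun γ hγ ↦ monomial_mem_initialAlgebra (h γ hγ) _

theorem isWeightedGraded_initialAlgebra : IsWeightedGraded 1 (initialAlgebra m S).toSubmodule := by
  intro p hp i
  rw [Subalgebra.mem_toSubmodule, mem_initialAlgebra_iff] at hp ⊢
  intro γ hγ
  rw [support_weightedHomogeneousComponent] at hγ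
  exact hp γ (Finset.mem_filter.mp hγ).1

theorem degreeSet_initialAlgebra :
    degreeSet m (initialAlgebra m S).toSubmodule = degreeSet m S.toSubmodule := by
  ext γ
  constructor
  · rintro ⟨p, hp, hp0, rfl⟩
    exact mem_initialAlgebra_iff.mp hp _ (m.degree_mem_support hp0)
  · rintro ⟨f, hf, hf0, rfl⟩
    exact ⟨m.leadingTerm f, Algebra.subset_adjoin ⟨f, hf, rfl⟩,
      (m.leadingTerm_eq_zero_iff f).not.mpr hf0, m.degree_leadingTerm f⟩

theorem poincareSeries_initialAlgebra (hS : IsWeightedGraded 1 S.toSubmodule) :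
    poincareSeries (degreePiece (initialAlgebra m S)) = poincareSeries (degreePiece S) := by
  have hfinrank (A : Subalgebra k (MvPolynomial (Fin n) k)) (hA : IsWeightedGraded 1 A.toSubmodule)
      (i : ℕ) : Module.finrank k (degreePiece A i) =
        (degreeSet m A.toSubmodule ∩ {γ | Finsupp.weight 1 γ = i}).ncard := by
    rw [finrank_degreePiece, ← degreeSet_inf_weightedHomogeneousSubmodule m hA]
    exact finrank_eq_ncard_degreeSet m _
  funext t
  refine tsum_congr fun i ↦ ?_
  rw [hfinrank _ isWeightedGraded_initialAlgebra, hfinrank _ hS, degreeSet_initialAlgebra]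

end InitialAlgebra

section MonomialExponents

theorem exists_add_nsmul_sum_eq_of_sum_zsmul_eq {ι G : Type*} {v : G → ι →₀ ℕ}
    {T : Finset G} {γ : ι →₀ ℕ} {a : G → ℤ} (ha : ∀ i, ∑ t ∈ T, a t * v t i = γ i) :
    ∃ (M : ℕ) (e : G → ℕ), γ + M • ∑ t ∈ T, v t = ∑ t ∈ T, e t • v t := by
  set M := ∑ t ∈ T, (a t).natAbs
  have hnonneg : ∀ t ∈ T, 0 ≤ a t + M := fun t ht ↦ by
    have : (a t).natAbs ≤ M :=
      Finset.single_le_sum (f := fun t ↦ (a t).natAbs) (fun _ _ ↦ Nat.zero_le _) ht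
    lia
  refine ⟨M, fun t ↦ (a t + M).toNat, Finsupp.ext fun i ↦ Nat.cast_injective (R := ℤ) ?_⟩
  simp only [Finsupp.add_apply, Finsupp.smul_apply, Finsupp.finsetSum_apply, smul_eq_mul,
    Nat.cast_add, Nat.cast_mul, Nat.cast_sum]
  rw [← ha, Finset.mul_sum, ← Finset.sum_add_distrib]
  refine Finset.sum_congr rfl fun t ht ↦ ?_
  rw [Int.toNat_of_nonneg (hnonneg t ht), add_mul]

theorem exists_finset_forall_exists_add_nsmul_sum_eq {ι G : Type*} [Finite ι]
    (v : G → ι →₀ ℕ) : ∃ T : Finset G, ∀ g, ∃ (M : ℕ) (e : G → ℕ),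
      v g + M • ∑ t ∈ T, v t = ∑ t ∈ T, e t • v t := by
  classical
  set u : G → ι → ℤ := fun g i ↦ v g i
  obtain ⟨U, hU, hspan⟩ := Submodule.fg_span_iff_fg_span_finset_subset (Set.range u) |>.mp
    (IsNoetherian.noetherian (Submodule.span ℤ _))
  rw [← Set.image_univ] at hU
  obtain ⟨T, -, rfl⟩ := Finset.subset_set_image_iff.mp hU
  refine ⟨T, fun g ↦ ?_⟩
  have hmem : u g ∈ Submodule.span ℤ (u '' T) := by
    rw [← Finset.coe_image, ← hspan]
    exact Submodule.subset_span ⟨g, rfl⟩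
  obtain ⟨a, ha⟩ := Submodule.mem_span_image_finset_iff_exists_fun' ℤ |>.mp hmem
  refine exists_add_nsmul_sum_eq_of_sum_zsmul_eq (a := a) fun i ↦ ?_
  simpa using congrFun ha i

theorem exists_mul_pow_mem_of_mem_span {R A : Type*} [CommSemiring R] [CommRing A] [Algebra R A]
    {B : Subalgebra R A} {f : A} (hf : f ∈ B) {s : Set A} (hs : ∀ x ∈ s, ∃ M : ℕ, x * f ^ M ∈ B)
    {a : A} (ha : a ∈ Submodule.span R s) : ∃ M : ℕ, a * f ^ M ∈ B := by
  induction ha using Submodule.span_induction with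
  | mem x hx => exact hs x hx
  | zero => exact ⟨0, by simp⟩
  | add x y _ _ hx hy =>
    obtain ⟨M, hM⟩ := hx
    obtain ⟨N, hN⟩ := hy
    refine ⟨M + N, ?_⟩
    rw [add_mul, pow_add, ← mul_assoc, mul_left_comm y]
    exact add_mem (mul_mem hM (pow_mem hf N)) (mul_mem (pow_mem hf M) hN)
  | smul c x _ hx =>
    obtain ⟨M, hM⟩ := hx
    exact ⟨M, by simpa only [smul_mul_assoc] using B.smul_mem hM c⟩

end MonomialExponents

section InitialAlgebraDimension

open MvPolynomial

variable {k : Type*} [Field k] {n : ℕ} {m : MonomialOrder (Fin n)}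
  {S : Subalgebra k (MvPolynomial (Fin n) k)}

/-- The monomials lying in the initial algebra, indexed by their exponents. -/
def initialMonomial (m : MonomialOrder (Fin n)) (S : Subalgebra k (MvPolynomial (Fin n) k))
    (γ : degreeSet m S.toSubmodule) : initialAlgebra m S :=
  ⟨monomial γ 1, monomial_mem_initialAlgebra γ.2 1⟩

theorem span_range_initialMonomial : Submodule.span k (Set.range (initialMonomial m S)) = ⊤ := by
  refine eq_top_iff.mpr fun p _ ↦ ?_
  have hsupp := mem_initialAlgebra_iff.mp p.2
  have hp : p = ∑ γ ∈ p.1.support.attach, p.1.coeff γ • initialMonomial m S ⟨γ, hsupp γ γ.2⟩ := by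
    apply Subtype.ext
    rw [AddSubmonoidClass.coe_finsetSum]
    nth_rewrite 1 [p.1.as_sum, ← Finset.sum_attach]
    refine Finset.sum_congr rfl fun γ _ ↦ ?_
    change _ = p.1.coeff γ • monomial γ.1 1
    rw [smul_monomial, smul_eq_mul, mul_one]
  rw [hp]
  exact sum_mem fun γ _ ↦ Submodule.smul_mem _ _ (Submodule.subset_span ⟨_, rfl⟩)

theorem exists_fg_forall_mul_pow_mem_initialAlgebra :
    ∃ (B : Subalgebra k (initialAlgebra m S)) (f : initialAlgebra m S), B.FG ∧ f ≠ 0 ∧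
      ∀ a, ∃ M : ℕ, a * f ^ M ∈ B := by
  obtain ⟨T, hT⟩ := exists_finset_forall_exists_add_nsmul_sum_eq
    fun γ : degreeSet m S.toSubmodule ↦ γ.1
  set x := initialMonomial m S
  set B := Algebra.adjoin k (x '' T)
  set f := ∏ t ∈ T, x t
  have hx : ∀ t ∈ T, x t ∈ B := fun t ht ↦ Algebra.subset_adjoin ⟨t, ht, rfl⟩
  have hprod (e : degreeSet m S.toSubmodule → ℕ) :
      (∏ t ∈ T, x t ^ e t).1 = monomial (∑ t ∈ T, e t • t.1) 1 := by
    rw [SubmonoidClass.coe_finsetProd, monomial_sum_one]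
    refine Finset.prod_congr rfl fun t _ ↦ ?_
    change monomial t.1 1 ^ e t = _
    rw [monomial_pow, one_pow]
  have hf : f.1 = monomial (∑ t ∈ T, t.1) 1 := by
    simpa only [Pi.one_apply, pow_one, one_smul] using hprod 1
  refine ⟨B, f, Subalgebra.fg_def.mpr ⟨_, T.finite_toSet.image x, rfl⟩, fun h0 ↦ ?_, fun a ↦
    exists_mul_pow_mem_of_mem_span (R := k) (prod_mem hx) ?_
      (span_range_initialMonomial (m := m) (S := S) ▸ Submodule.mem_top)⟩
  · rw [h0, ZeroMemClass.coe_zero, eq_comm, monomial_eq_zero] at hf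
    exact one_ne_zero hf
  · rintro _ ⟨γ, rfl⟩
    obtain ⟨M, e, he⟩ := hT γ
    have h : x γ * f ^ M = ∏ t ∈ T, x t ^ e t := by
      apply Subtype.ext
      change monomial γ.1 1 * f.1 ^ M = _
      rw [hf, monomial_pow, one_pow, monomial_mul, mul_one, he, hprod]
    exact ⟨M, h ▸ prod_mem fun t ht ↦ pow_mem (hx t ht) _⟩

theorem ringKrullDim_initialAlgebra {d : ℕ} (hd : Algebra.trdeg k (initialAlgebra m S) = d) :
    ringKrullDim (initialAlgebra m S) = d := by
  obtain ⟨B, f, hB, hf, h⟩ := exists_fg_forall_mul_pow_mem_initialAlgebra (m := m) (S := S)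
  have := finiteType_localizationAway_of_fg hB h
  exact ringKrullDim_eq_of_finiteType_localizationAway hd hf

end InitialAlgebraDimension

end

theorem corollary5p5 {k : Type*} [Field k] {n : ℕ} (m : MonomialOrder (Fin n))
    (S : Subalgebra k (MvPolynomial (Fin n) k)) (hS : IsFGHomogeneous S) :
    IsHilbertSerre (degreePiece S) ∧
    IsHilbertSerre (degreePiece (initialAlgebra m S)) ∧
    ∃ d : ℕ,
      (ringKrullDim S = (d : WithBot ℕ∞) ∧
        Algebra.trdeg k S = (d : Cardinal) ∧
        gkDim k S = ((d : ℝ) : EReal) ∧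
        hilbertSerreDim (degreePiece S) = d) ∧
      (ringKrullDim (initialAlgebra m S) = (d : WithBot ℕ∞) ∧
        Algebra.trdeg k (initialAlgebra m S) = (d : Cardinal) ∧
        gkDim k (initialAlgebra m S) = ((d : ℝ) : EReal) ∧
        hilbertSerreDim (degreePiece (initialAlgebra m S)) = d) := by
  obtain ⟨r, f, w, hf, hw, rfl⟩ := hS.exists_generators
  set S := Algebra.adjoin k (Set.range f)
  have hgr : IsWeightedGraded 1 S.toSubmodule := isWeightedGraded_adjoin_range hf
  obtain ⟨P, hP, hSP⟩ := exists_meromorphicAt_poincareSeries_adjoin_range_eq hf hw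
  have hin := poincareSeries_initialAlgebra (m := m) hgr
  have : Algebra.FiniteType k S :=
    (Subalgebra.fg_iff_finiteType S).mp (Subalgebra.fg_def.mpr ⟨_, Set.finite_range f, rfl⟩)
  obtain ⟨d, hd, hdim⟩ := exists_trdeg_eq_ringKrullDim_of_finiteType k S
  obtain ⟨e, he⟩ := exists_trdeg_eq (initialAlgebra m S)
  obtain ⟨hHS, hHSd⟩ := isHilbertSerre_and_hilbertSerreDim_eq hgr hd hP hSP
  obtain ⟨hHSin, hHSine⟩ :=
    isHilbertSerre_and_hilbertSerreDim_eq isWeightedGraded_initialAlgebra he hP (hin ▸ hSP)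
  have hde : e = d := by
    rw [← hHSd, ← hHSine]
    simp only [hilbertSerreDim, poleExponents, hin]
  subst hde
  exact ⟨hHS, hHSin, e, ⟨hdim, hd, gkDim_eq_of_trdeg_eq S hd, hHSd⟩,
    ringKrullDim_initialAlgebra he, he, gkDim_eq_of_trdeg_eq _ he, hHSine⟩
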